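/- Let $\mathcal S=\{0,\dots,\ell-1\}$ and let $X=(X_k)_{k\ge1}$ be a homogeneous Markov chain on $\mathcal S$ with initial distribution $p=(p_i)_{i\in\mathcal S}$ and transition matrix $P=(p_{ij})_{i,j\in\mathcal S}$. Assume that $P$ is irreducible (for all $i,j\in\mathcal S$ there is $k\ge1$ with $(P^k)_{ij}>0$) and that $p_{ij}\neq1$ for all $i,j\in\mathcal S$ (so that $\ell\ge2$). For a word $\varepsilon_1\cdots\varepsilon_n\in\mathcal S^n$ put $$I_{\varepsilon_1\cdots\varepsilon_n}=\Big[\sum_{i=1}^n\frac{\varepsilon_i}{\ell^i},\ \sum_{i=1}^n\frac{\varepsilon_i}{\ell^i}+\frac1{\ell^n}\Big),$$ let $\mathcal F_n$ be the family of these $\ell$-adic intervals of order $n$, and let $m$ be the Borel probability measure on $\mathbb R$ determined by $$m(I_{\varepsilon_1\cdots\varepsilon_n})=\mathbb P(X_1=\varepsilon_1,\dots,X_n=\varepsilon_n)\qquad(n\ge1,\ \varepsilon_1\cdots\varepsilon_n\in\mathcal S^n),$$ that is, the law of $\sum_{k\ge1}X_k\ell^{-k}$. For $q\in\mathbb R$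 let $$\tau(q)=\limsup_{n\to\infty}\frac1{n\log\ell}\log\Big(\sum_{I\in\mathcal F_n}m(I)^q\Big),$$ with the convention $0^q=0$ for every $q\in\mathbb R$. Then $\tau$ is differentiable at $1$, and the measure $m$ is unidimensional with dimension $-\tau'(1)$: its lower and upper Hausdorff dimensions coincide and $$\inf\{\dim_H E:\ E \text{ Borel},\ m(E)>0\}=\inf\{\dim_H E:\ E\text{ Borel},\ m(E)=1\}=-\tau'(1).$$ -/

import Mathlib

open MeasureTheory ProbabilityTheory Filter
open scoped ENNReal NNReal

namespace MarkovMeasure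

/-- `X 0, X 1, X 2, …` is a homogeneous Markov chain on the state space `{0, …, ℓ - 1}` with initial
distribution `p` and transition matrix `P`. (The chain is indexed from `0`, so `X k` is the `(k+1)`-st
variable of the chain.) -/
structure IsMarkovChain {ℓ : ℕ} {Ω : Type*} [MeasurableSpace Ω] (Pr : Measure Ω)
    (X : ℕ → Ω → Fin ℓ) (p : Fin ℓ → ℝ) (P : Matrix (Fin ℓ) (Fin ℓ) ℝ) : Prop where
  initial_mem : p ∈ stdSimplex ℝ (Fin ℓ)
  matrix_mem : P ∈ Matrix.rowStochastic ℝ (Fin ℓ)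
  measurable : ∀ k, Measurable (X k)
  initial : ∀ i, Pr.real {ω | X 0 ω = i} = p i
  transition : ∀ (n : ℕ) (x : ℕ → Fin ℓ) (j : Fin ℓ),
    Pr {ω | ∀ k ≤ n, X k ω = x k} ≠ 0 →
      (Pr[|{ω | ∀ k ≤ n, X k ω = x k}]).real {ω | X (n + 1) ω = j} = P (x n) j

/-- The `ℓ`-adic interval `I_ε` of order `n` attached to the word `ε = ε_0 ⋯ ε_{n-1}`: the numbers
of `[0, 1)` whose expansion in base `ℓ` starts with the digits `ε_0, …, ε_{n-1}`. -/
noncomputable def adicInterval {ℓ n : ℕ} (ε : Fin n → Fin ℓ) : Set ℝ :=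
  Set.Ico (∑ i : Fin n, ((ε i : ℕ) : ℝ) / (ℓ : ℝ) ^ ((i : ℕ) + 1))
    (∑ i : Fin n, ((ε i : ℕ) : ℝ) / (ℓ : ℝ) ^ ((i : ℕ) + 1) + 1 / (ℓ : ℝ) ^ n)

/-- The measure driven by the process `X`: the law of the random real number
`∑ k, X k / ℓ ^ (k + 1)`, whose digits in base `ℓ` are `X 0, X 1, …`. The identity
`m (I_ε) = Pr (X 0 = ε_0, …, X (n-1) = ε_{n-1})` is `drivenMeasure_adicInterval` below. -/
noncomputable def drivenMeasure {ℓ : ℕ} {Ω : Type*} [MeasurableSpace Ω] (Pr : Measure Ω)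
    (X : ℕ → Ω → Fin ℓ) : Measure ℝ :=
  Pr.map (fun ω => Real.ofDigits (fun k => X k ω))

/-- The power `x ^ q` with the convention `0 ^ q = 0` for every real `q` (also for `q = 0`). -/
noncomputable def pow₀ (x q : ℝ) : ℝ := if x = 0 then 0 else x ^ q

/-- The structure function `τ(q) = limsup (1 / (n log ℓ)) log ∑ m(I) ^ q`, the sum being over the
`ℓ`-adic intervals `I` of order `n`. -/
noncomputable def structureFunction (ℓ : ℕ) (m : Measure ℝ) (q : ℝ) : ℝ :=
  limsup (fun n : ℕ => 1 / ((n : ℝ) * Real.log ℓ) *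
    Real.log (∑ ε : Fin n → Fin ℓ, pow₀ (m.real (adicInterval ε)) q)) atTop

/-- The lower Hausdorff dimension of a measure, `inf {dim_H E : μ E > 0}`. -/
noncomputable def lowerDim {α : Type*} [EMetricSpace α] [MeasurableSpace α] (μ : Measure α) :
    ℝ≥0∞ :=
  ⨅ (E : Set α) (_ : MeasurableSet E) (_ : 0 < μ E), dimH E

/-- The upper Hausdorff dimension of a probability measure, `inf {dim_H E : μ E = 1}`. -/
noncomputable def upperDim {α : Type*} [EMetricSpace α] [MeasurableSpace α] (μ : Measure α) :
    ℝ≥0∞ :=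
  ⨅ (E : Set α) (_ : MeasurableSet E) (_ : μ E = 1), dimH E

theorem word_eq_of_mem {ℓ : ℕ} (hℓ : 0 < ℓ) {x : ℝ} {n : ℕ} {ε δ : Fin n → Fin ℓ}
    (h₁ : x ∈ adicInterval ε) (h₂ : x ∈ adicInterval δ) : ε = δ := by
  induction n with
  | zero => exact Subsingleton.elim _ _
  | succ n ih =>
    have hl : (0 : ℝ) < ℓ := by exact_mod_cast hℓ
    have hpos : (0 : ℝ) < (ℓ : ℝ) ^ (n + 1) := by positivity
    have key : ∀ η : Fin (n + 1) → Fin ℓ, x ∈ adicInterval η →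
        x ∈ adicInterval (fun i : Fin n => η i.castSucc) := by
      intro η hη
      simp only [adicInterval, Fin.sum_univ_castSucc, Set.mem_Ico, Fin.val_castSucc,
        Fin.val_last] at hη ⊢
      have h0 : (0 : ℝ) ≤ ((η (Fin.last n) : ℕ) : ℝ) / (ℓ : ℝ) ^ (n + 1) := by positivity
      have h1 : ((η (Fin.last n) : ℕ) : ℝ) + 1 ≤ ℓ := by
        exact_mod_cast (η (Fin.last n)).isLt
      have h2 : ((η (Fin.last n) : ℕ) : ℝ) / (ℓ : ℝ) ^ (n + 1) + 1 / (ℓ : ℝ) ^ (n + 1)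
          ≤ 1 / (ℓ : ℝ) ^ n := by
        rw [← add_div, div_le_div_iff₀ hpos (by positivity), pow_succ, one_mul, mul_comm]
        exact mul_le_mul_of_nonneg_left h1 (by positivity)
      constructor <;> linarith [hη.1, hη.2]
    have hpre := ih (key ε h₁) (key δ h₂)
    have hlast : ε (Fin.last n) = δ (Fin.last n) := by
      simp only [adicInterval, Fin.sum_univ_castSucc, Set.mem_Ico, Fin.val_castSucc,
        Fin.val_last] at h₁ h₂
      have hs : ∑ i : Fin n, ((ε i.castSucc : ℕ) : ℝ) / (ℓ : ℝ) ^ ((i : ℕ) + 1)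
          = ∑ i : Fin n, ((δ i.castSucc : ℕ) : ℝ) / (ℓ : ℝ) ^ ((i : ℕ) + 1) :=
        Finset.sum_congr rfl fun i _ => by rw [congrFun hpre i]
      rw [hs] at h₁
      have a1 : ((ε (Fin.last n) : ℕ) : ℝ) / (ℓ : ℝ) ^ (n + 1)
          < (((δ (Fin.last n) : ℕ) : ℝ) + 1) / (ℓ : ℝ) ^ (n + 1) := by
        rw [add_div]; linarith [h₁.1, h₂.2]
      have a2 : ((δ (Fin.last n) : ℕ) : ℝ) / (ℓ : ℝ) ^ (n + 1)
          < (((ε (Fin.last n) : ℕ) : ℝ) + 1) / (ℓ : ℝ) ^ (n + 1) := by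
        rw [add_div]; linarith [h₂.1, h₁.2]
      rw [div_lt_div_iff_of_pos_right hpos] at a1 a2
      norm_cast at a1 a2
      exact Fin.ext (by omega)
    funext i
    refine Fin.lastCases hlast (fun i => congrFun hpre i) i

theorem eq_last_of_ofDigits_eq_one {ℓ : ℕ} (hℓ : 0 < ℓ) {a : ℕ → Fin ℓ}
    (h : Real.ofDigits a = 1) (k : ℕ) : (a k : ℕ) + 1 = ℓ := by
  have hl : (0 : ℝ) < ℓ := by exact_mod_cast hℓ
  have step : ∀ b : ℕ → Fin ℓ, Real.ofDigits b = 1 →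
      (b 0 : ℕ) + 1 = ℓ ∧ Real.ofDigits (fun i => b (i + 1)) = 1 := by
    intro b hb
    have e := Real.ofDigits_eq_sum_add_ofDigits b 1
    have u := Real.ofDigits_le_one (fun i => b (i + 1))
    have v : ((b 0 : ℕ) : ℝ) + 1 ≤ ℓ := by exact_mod_cast (b 0).isLt
    simp only [Finset.sum_range_one, Real.ofDigitsTerm, hb, zero_add, pow_one] at e
    have e' : (ℓ : ℝ) = (b 0 : ℕ) + Real.ofDigits (fun i => b (i + 1)) := by
      field_simp at e
      linarith
    have w : Real.ofDigits (fun i => b (i + 1)) = 1 := by linarith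
    refine ⟨?_, w⟩
    rw [w] at e'
    exact_mod_cast e'.symm
  induction k generalizing a with
  | zero => exact (step a h).1
  | succ k ih => exact ih (step a h).2

theorem ofDigits_mem_adicInterval {ℓ : ℕ} (hℓ : 0 < ℓ) (a : ℕ → Fin ℓ) (n : ℕ)
    (h : Real.ofDigits (fun i => a (i + n)) ≠ 1) :
    Real.ofDigits a ∈ adicInterval (fun i : Fin n => a i) := by
  have hl : (0 : ℝ) < ℓ := by exact_mod_cast hℓ
  have e := Real.ofDigits_eq_sum_add_ofDigits a n
  have hs : ∑ i : Fin n, ((a i : ℕ) : ℝ) / (ℓ : ℝ) ^ ((i : ℕ) + 1)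
      = ∑ i ∈ Finset.range n, Real.ofDigitsTerm a i := by
    rw [Fin.sum_univ_eq_sum_range (fun i => ((a i : ℕ) : ℝ) / (ℓ : ℝ) ^ (i + 1))]
    rfl
  have h0 := Real.ofDigits_nonneg (fun i => a (i + n))
  have h1 := lt_of_le_of_ne (Real.ofDigits_le_one (fun i => a (i + n))) h
  have hp : (0 : ℝ) < ((ℓ : ℝ) ^ n)⁻¹ := by positivity
  rw [adicInterval, Set.mem_Ico, hs, e, one_div]
  constructor
  · nlinarith
  · nlinarith

section

variable {ℓ : ℕ} {Ω : Type*} [MeasurableSpace Ω] {Pr : Measure Ω}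
  {X : ℕ → Ω → Fin ℓ} {p : Fin ℓ → ℝ} {P : Matrix (Fin ℓ) (Fin ℓ) ℝ}

theorem IsMarkovChain.pos (hX : IsMarkovChain Pr X p P) : 0 < ℓ := by
  rcases Nat.eq_zero_or_pos ℓ with h | h
  · subst h
    have := hX.initial_mem.2
    simp at this
  · exact h

theorem IsMarkovChain.measurableSet_path (hX : IsMarkovChain Pr X p P) (x : ℕ → Fin ℓ) (n : ℕ) :
    MeasurableSet {ω | ∀ k ≤ n, X k ω = x k} := by
  have : {ω | ∀ k ≤ n, X k ω = x k} = ⋂ k, ⋂ (_ : k ≤ n), X k ⁻¹' {x k} := by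
    ext ω; simp
  rw [this]
  exact MeasurableSet.iInter fun k => MeasurableSet.iInter fun _ =>
    hX.measurable k (measurableSet_singleton _)

theorem IsMarkovChain.path_succ [IsProbabilityMeasure Pr] (hX : IsMarkovChain Pr X p P)
    (x : ℕ → Fin ℓ) (n : ℕ) :
    Pr.real {ω | ∀ k ≤ n + 1, X k ω = x k}
      = Pr.real {ω | ∀ k ≤ n, X k ω = x k} * P (x n) (x (n + 1)) := by
  have hset : {ω | ∀ k ≤ n + 1, X k ω = x k}
      = {ω | ∀ k ≤ n, X k ω = x k} ∩ {ω | X (n + 1) ω = x (n + 1)} := by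
    ext ω
    simp only [Set.mem_ofPred_eq, Set.mem_inter_iff]
    refine ⟨fun h => ⟨fun k hk => h k (by omega), h _ le_rfl⟩, fun h k hk => ?_⟩
    rcases Nat.lt_or_ge n k with h' | h'
    · obtain rfl : k = n + 1 := by omega
      exact h.2
    · exact h.1 k h'
  by_cases h0 : Pr {ω | ∀ k ≤ n, X k ω = x k} = 0
  · have h1 : Pr {ω | ∀ k ≤ n + 1, X k ω = x k} = 0 :=
      measure_mono_null (by rw [hset]; exact Set.inter_subset_left) h0
    simp [measureReal_def, h0, h1]
  · rw [← hX.transition n x (x (n + 1)) h0, hset, measureReal_def, measureReal_def,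
      measureReal_def, ← cond_mul_eq_inter (hX.measurableSet_path x n), ENNReal.toReal_mul,
      mul_comm]

/-- A chain without deterministic transitions almost surely does not follow a given path that is
eventually constant. -/
theorem IsMarkovChain.path_null [IsProbabilityMeasure Pr] (hX : IsMarkovChain Pr X p P)
    (hdeg : ∀ i j, P i j ≠ 1)
    (x : ℕ → Fin ℓ) (n : ℕ) (c : Fin ℓ) (hx : ∀ k, n ≤ k → x k = c) :
    Pr {ω | ∀ k, X k ω = x k} = 0 := by
  have hP := Matrix.mem_rowStochastic_iff_sum.1 hX.matrix_mem
  have hc0 : 0 ≤ P c c := hP.1 c c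
  have hc1 : P c c < 1 :=
    lt_of_le_of_ne (Matrix.le_one_of_mem_rowStochastic hX.matrix_mem) (hdeg c c)
  have hj : ∀ j : ℕ, Pr.real {ω | ∀ k ≤ n + j, X k ω = x k} ≤ P c c ^ j := by
    intro j
    induction j with
    | zero => simp
    | succ j ih =>
      rw [← add_assoc, hX.path_succ, hx (n + j) (by omega), hx (n + j + 1) (by omega), pow_succ]
      exact mul_le_mul_of_nonneg_right ih hc0
  have hle : Pr.real {ω | ∀ k, X k ω = x k} ≤ 0 := by
    refine ge_of_tendsto' (tendsto_pow_atTop_nhds_zero_of_lt_one hc0 hc1) fun j => ?_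
    refine le_trans (measureReal_mono ?_) (hj j)
    intro ω hω k _
    exact hω k
  exact (measureReal_eq_zero_iff).1 (le_antisymm hle measureReal_nonneg)

theorem IsMarkovChain.ae_tail_ne_one [IsProbabilityMeasure Pr] (hX : IsMarkovChain Pr X p P)
    (hdeg : ∀ i j, P i j ≠ 1)
    (n : ℕ) : ∀ᵐ ω ∂Pr, Real.ofDigits (fun i => X (i + n) ω) ≠ 1 := by
  have hℓ := hX.pos
  let c : Fin ℓ := ⟨ℓ - 1, by omega⟩
  have hnull : ∀ η : Fin n → Fin ℓ, ∀ᵐ ω ∂Pr,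
      ¬ ∀ k, X k ω = (fun k => if h : k < n then η ⟨k, h⟩ else c) k := by
    intro η
    rw [ae_iff]
    simp only [not_not]
    exact hX.path_null hdeg _ n c fun k hk => dif_neg (by omega)
  filter_upwards [ae_all_iff.2 hnull] with ω hω h1
  refine hω (fun i => X i ω) fun k => ?_
  by_cases hk : k < n
  · simp [hk]
  · have := eq_last_of_ofDigits_eq_one hℓ h1 (k - n)
    simp only [Nat.sub_add_cancel (not_lt.1 hk)] at this
    simp only [hk, dite_false]
    exact Fin.ext (by simp only [c]; omega)

/-- The measure of an `ℓ`-adic interval is the probability of the corresponding trajectory. -/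
theorem drivenMeasure_adicInterval [IsProbabilityMeasure Pr] (hX : IsMarkovChain Pr X p P)
    (hdeg : ∀ i j, P i j ≠ 1)
    {n : ℕ} (ε : Fin n → Fin ℓ) :
    drivenMeasure Pr X (adicInterval ε) = Pr {ω | ∀ i : Fin n, X i ω = ε i} := by
  have hmeas : Measurable (fun ω => Real.ofDigits (fun k => X k ω)) :=
    Real.continuous_ofDigits.measurable.comp (measurable_pi_lambda _ hX.measurable)
  have hI : MeasurableSet (adicInterval ε) := measurableSet_Ico
  rw [drivenMeasure, Measure.map_apply hmeas hI]
  refine measure_congr ?_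
  filter_upwards [hX.ae_tail_ne_one hdeg n] with ω hω
  have hmem := ofDigits_mem_adicInterval hX.pos (fun k => X k ω) n hω
  refine propext ⟨fun h i => ?_, fun h => ?_⟩
  · exact congrFun (word_eq_of_mem hX.pos hmem h) i
  · have : (fun i : Fin n => X i ω) = ε := funext h
    rw [this] at hmem
    exact hmem

theorem isProbabilityMeasure_drivenMeasure [IsProbabilityMeasure Pr] (hX : IsMarkovChain Pr X p P) :
    IsProbabilityMeasure (drivenMeasure Pr X) :=
  Measure.isProbabilityMeasure_map
    (Real.continuous_ofDigits.measurable.comp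
      (measurable_pi_lambda _ hX.measurable)).aemeasurable

end

end MarkovMeasure

/-! The number `h` is the entropy rate of the chain, obtained from the Poisson equation `u - P u = g
- h`, where `g i` is the entropy of row `i` (`exists_poisson`). With `w = -u`, the vector `exp (s
w)` is almost an eigenvector of the matrix with entries `P i j ^ (1 + s)`: the eigenvalue is `exp
(-s h)`, with relative error `exp (o(s))` as `s → 0` (`log_moment_isLittleO`). Each new letter
therefore multiplies the weighted partition sums by `exp (-s h + o(s))`, which gives `HasEntropy`
without Perron–Frobenius theory or an ergodic theorem.

The rest uses `HasEntropy` alone, together with the fact that the intervals of each order carry the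
whole mass. Dividing by `n log ℓ` gives `τ'(1) = -h / log ℓ`. Chernoff bounds with small `s` of
either sign, followed by Borel–Cantelli, show that the interval of order `n` around almost every
point has measure `exp (-n (h + o(1)))`. A covering argument and the mass distribution principle
then squeeze both dimensions to `h / log ℓ`. -/

namespace MarkovMeasure

open Topology

/-! ### The Poisson equation of an irreducible stochastic matrix. -/

section Poisson

variable {ι : Type*} [Fintype ι] {P : Matrix ι ι ℝ}

/-- The maximum principle: a harmonic function of an irreducible stochastic matrix is constant. -/
theorem harmonic_const [Nonempty ι] (hsum : ∀ i, ∑ j, P i j = 1) (hirr : P.IsIrreducible)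
    {v : ι → ℝ} (hv : ∀ i, ∑ j, P i j * v j = v i) (i j : ι) : v i = v j := by
  obtain ⟨a, ha⟩ := Finite.exists_max v
  have step : ∀ i j, v i = v a → 0 < P i j → v j = v a := by
    intro i j hi hij
    have h0 : ∑ k, P i k * (v a - v k) = 0 := by
      simp only [mul_sub, Finset.sum_sub_distrib, ← Finset.sum_mul, hsum, hv, hi]
      ring
    have h1 := (Finset.sum_eq_zero_iff_of_nonneg fun k _ =>
      mul_nonneg (hirr.nonneg i k) (sub_nonneg.2 (ha k))).1 h0 j (Finset.mem_univ j)
    rcases mul_eq_zero.1 h1 with h | h <;> linarith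
  have key : ∀ k, v k = v a := by
    intro k
    let : Quiver ι := P.toQuiver
    obtain ⟨q, -⟩ := hirr.connected a k
    induction q with
    | nil => rfl
    | cons _ e ih => exact step _ _ ih e.down
  rw [key i, key j]

/-- The Poisson equation `(1 - P) u = g - h` of an irreducible stochastic matrix is solvable for
some constant `h`. -/
theorem exists_poisson [Nonempty ι] (hsum : ∀ i, ∑ j, P i j = 1) (hirr : P.IsIrreducible)
    (g : ι → ℝ) : ∃ (h : ℝ) (u : ι → ℝ), ∀ i, u i - ∑ j, P i j * u j = g i - h := by
  classical
  obtain ⟨o⟩ := ‹Nonempty ι›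
  -- `1 - P` kills the constants; adding the rank-one map `u ↦ u o` makes it injective, hence
  -- surjective. The constant `h` is then the value `u o`.
  let A : (ι → ℝ) →ₗ[ℝ] (ι → ℝ) :=
    LinearMap.id - P.mulVecLin + LinearMap.pi fun _ => LinearMap.proj o
  have hA : ∀ u i, A u i = u i - ∑ j, P i j * u j + u o := fun u i => rfl
  have hinj : Function.Injective A := by
    rw [injective_iff_map_eq_zero]
    intro u hu
    have hu' : ∀ i, u i - ∑ j, P i j * u j + u o = 0 := fun i => by rw [← hA, hu]; rfl
    obtain ⟨a, ha⟩ := Finite.exists_max u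
    obtain ⟨b, hb⟩ := Finite.exists_min u
    -- The equation at a maximum gives `u o ≤ 0`, and at a minimum `u o ≥ 0`.
    have h1 : ∑ j, P a j * u j ≤ u a := by
      calc ∑ j, P a j * u j ≤ ∑ j, P a j * u a :=
            Finset.sum_le_sum fun j _ => mul_le_mul_of_nonneg_left (ha j) (hirr.nonneg a j)
        _ = u a := by rw [← Finset.sum_mul, hsum, one_mul]
    have h2 : u b ≤ ∑ j, P b j * u j := by
      calc u b = ∑ j, P b j * u b := by rw [← Finset.sum_mul, hsum, one_mul]
        _ ≤ _ := Finset.sum_le_sum fun j _ => mul_le_mul_of_nonneg_left (hb j) (hirr.nonneg b j)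
    have h0 : u o = 0 := by linarith [hu' a, hu' b]
    funext i
    have := harmonic_const hsum hirr (v := u) (fun i => by linarith [hu' i]) i o
    rw [this, h0]
    rfl
  obtain ⟨u, hu⟩ := LinearMap.injective_iff_surjective.1 hinj g
  exact ⟨u o, u, fun i => by rw [← hu, hA]; ring⟩

/-- At a minimum of `u` the left side of the equation is at most `0`, so `h` is at least the value
of `g` there. -/
theorem poisson_const_nonneg [Nonempty ι] (hsum : ∀ i, ∑ j, P i j = 1)
    (hnonneg : ∀ i j, 0 ≤ P i j) {g u : ι → ℝ} {h : ℝ} (hg : ∀ i, 0 ≤ g i)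
    (hu : ∀ i, u i - ∑ j, P i j * u j = g i - h) : 0 ≤ h := by
  obtain ⟨b, hb⟩ := Finite.exists_min u
  have h2 : u b ≤ ∑ j, P b j * u j := by
    calc u b = ∑ j, P b j * u b := by rw [← Finset.sum_mul, hsum, one_mul]
      _ ≤ _ := Finset.sum_le_sum fun j _ => mul_le_mul_of_nonneg_left (hb j) (hnonneg b j)
  linarith [hu b, hg b]

end Poisson

/-! ### Powers with `0 ^ q = 0` and moments of a probability vector. -/

theorem pow₀_nonneg {x : ℝ} (hx : 0 ≤ x) (q : ℝ) : 0 ≤ pow₀ x q := by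
  unfold pow₀
  split_ifs
  · exact le_rfl
  · exact Real.rpow_nonneg hx q

theorem pow₀_pos {x : ℝ} (hx : 0 < x) (q : ℝ) : 0 < pow₀ x q := by
  simpa [pow₀, hx.ne'] using Real.rpow_pos_of_pos hx q

theorem pow₀_mul {x y : ℝ} (hx : 0 ≤ x) (hy : 0 ≤ y) (q : ℝ) :
    pow₀ (x * y) q = pow₀ x q * pow₀ y q := by
  unfold pow₀
  by_cases h : x = 0
  · simp [h]
  by_cases h' : y = 0
  · simp [h']
  simp [h, h', Real.mul_rpow hx hy]

/-- The right side is smooth in `s` even when `x = 0`: the factor `x` hides the default value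
`Real.log 0 = 0`. -/
theorem pow₀_one_add_mul_exp (x s w : ℝ) (hx : 0 ≤ x) :
    pow₀ x (1 + s) * Real.exp (s * w) = x * Real.exp (s * (Real.log x + w)) := by
  unfold pow₀
  rcases hx.eq_or_lt with h | h
  · simp [← h]
  · rw [if_neg h.ne', Real.rpow_add h, Real.rpow_one, Real.rpow_def_of_pos h, mul_assoc,
      ← Real.exp_add]
    ring_nf

/-- The first order expansion of the logarithm of a weighted moment sum of a probability
vector. -/
theorem log_moment_isLittleO {ι : Type*} [Fintype ι] {a : ι → ℝ} (ha : ∀ j, 0 ≤ a j)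
    (hsum : ∑ j, a j = 1) (w : ι → ℝ) {c : ℝ} (hc : ∑ j, a j * (Real.log (a j) + w j) = c)
    {δ : ℝ} (hδ : 0 < δ) :
    ∀ᶠ s in 𝓝 (0 : ℝ), 0 < ∑ j, pow₀ (a j) (1 + s) * Real.exp (s * w j) ∧
      |Real.log (∑ j, pow₀ (a j) (1 + s) * Real.exp (s * w j)) - s * c| ≤ δ * |s| := by
  have hF : ∀ s, ∑ j, pow₀ (a j) (1 + s) * Real.exp (s * w j)
      = ∑ j, a j * Real.exp (s * (Real.log (a j) + w j)) := fun s =>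
    Finset.sum_congr rfl fun j _ => pow₀_one_add_mul_exp _ _ _ (ha j)
  simp only [hF]
  have hpos : ∀ s : ℝ, 0 < ∑ j, a j * Real.exp (s * (Real.log (a j) + w j)) := by
    intro s
    obtain ⟨j, -, hj⟩ : ∃ j ∈ Finset.univ, 0 < a j := by
      by_contra! hcon
      have := Finset.sum_nonpos hcon
      rw [hsum] at this
      linarith
    exact Finset.sum_pos' (fun j _ => mul_nonneg (ha j) (Real.exp_pos _).le)
      ⟨j, Finset.mem_univ j, mul_pos hj (Real.exp_pos _)⟩
  have hd : HasDerivAt (fun s : ℝ => ∑ j, a j * Real.exp (s * (Real.log (a j) + w j))) c 0 := by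
    rw [← hc]
    refine HasDerivAt.fun_sum fun j _ => ?_
    have := (((hasDerivAt_id (0 : ℝ)).mul_const (Real.log (a j) + w j)).exp).const_mul (a j)
    simpa using this
  -- The moment sum equals `1` at `s = 0`, so its logarithm vanishes there and has the same
  -- derivative `c`.
  have hl := hd.log (hpos 0).ne'
  simp only [zero_mul, Real.exp_zero, mul_one, hsum, div_one] at hl
  have ho := hasDerivAt_iff_isLittleO.1 hl
  filter_upwards [ho.def hδ] with s hs
  refine ⟨hpos s, ?_⟩
  simpa [hsum] using hs

/-! ### Growth of the partition sums of the driven measure. -/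

/-- The sum `∑ m(I) ^ q` over the `ℓ`-adic intervals of order `n`. -/
noncomputable def partitionSum (ℓ : ℕ) (m : Measure ℝ) (n : ℕ) (q : ℝ) : ℝ :=
  ∑ ε : Fin n → Fin ℓ, pow₀ (m.real (adicInterval ε)) q

/-- `m` has entropy `h`: the partition sums satisfy `log ∑ m(I) ^ (1 + s) = -n (s h + o(s))`,
up to a bounded error for each `s`. -/
def HasEntropy (ℓ : ℕ) (m : Measure ℝ) (h : ℝ) : Prop :=
  ∀ δ > 0, ∀ᶠ s in 𝓝 (0 : ℝ), ∃ K, ∀ n : ℕ, 0 < partitionSum ℓ m n (1 + s) ∧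
    |Real.log (partitionSum ℓ m n (1 + s)) + n * (s * h)| ≤ n * (δ * |s|) + K

section

variable {ℓ : ℕ} {Ω : Type*} [MeasurableSpace Ω] {Pr : Measure Ω}
  {X : ℕ → Ω → Fin ℓ} {p : Fin ℓ → ℝ} {P : Matrix (Fin ℓ) (Fin ℓ) ℝ}

theorem IsMarkovChain.real_adicInterval_snoc [IsProbabilityMeasure Pr]
    (hX : IsMarkovChain Pr X p P) (hdeg : ∀ i j, P i j ≠ 1) {n : ℕ} (ε : Fin (n + 1) → Fin ℓ)
    (j : Fin ℓ) :
    (drivenMeasure Pr X).real (adicInterval (Fin.snoc ε j : Fin (n + 2) → Fin ℓ))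
      = (drivenMeasure Pr X).real (adicInterval ε) * P (ε (Fin.last n)) j := by
  -- `path_succ` takes an infinite path: the word `ε` is continued by the constant letter `j`.
  have h := hX.path_succ (fun k => if h : k < n + 1 then ε ⟨k, h⟩ else j) n
  simp only [lt_add_iff_pos_right, zero_lt_one, dite_true, lt_irrefl, dite_false] at h
  simp only [measureReal_def, drivenMeasure_adicInterval hX hdeg]
  simp only [← measureReal_def]
  have e1 : {ω | ∀ i : Fin (n + 2), X i ω = (Fin.snoc ε j : Fin (n + 2) → Fin ℓ) i}
      = {ω | ∀ k ≤ n + 1, X k ω = if h : k < n + 1 then ε ⟨k, h⟩ else j} := by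
    ext ω
    simp only [Set.mem_ofPred_eq]
    constructor
    · intro H k hk
      by_cases hk' : k < n + 1
      · simpa [Fin.snoc, Fin.castLT, hk'] using H ⟨k, by omega⟩
      · simpa [Fin.snoc, Fin.castLT, hk'] using H ⟨k, by omega⟩
    · intro H i
      simpa [Fin.snoc, Fin.castLT] using H i (by omega)
  have e2 : {ω | ∀ i : Fin (n + 1), X i ω = ε i}
      = {ω | ∀ k ≤ n, X k ω = if h : k < n + 1 then ε ⟨k, h⟩ else j} := by
    ext ω
    simp only [Set.mem_ofPred_eq]
    constructor
    · intro H k hk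
      simpa [Nat.lt_succ_iff.2 hk] using H ⟨k, by omega⟩
    · intro H i
      simpa [Fin.is_le i] using H i (by omega)
  rw [e1, e2]
  exact h

theorem IsMarkovChain.sum_real_adicInterval [IsProbabilityMeasure Pr]
    (hX : IsMarkovChain Pr X p P) (hdeg : ∀ i j, P i j ≠ 1) (n : ℕ) :
    ∑ ε : Fin n → Fin ℓ, drivenMeasure Pr X (adicInterval ε) = 1 := by
  simp only [drivenMeasure_adicInterval hX hdeg]
  have hm : Measurable fun ω => fun i : Fin n => X i ω :=
    measurable_pi_lambda _ fun i => hX.measurable i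
  have := sum_measure_preimage_singleton (μ := Pr) (f := fun ω => fun i : Fin n => X i ω)
    (Finset.univ) (fun ε _ => hm (measurableSet_singleton ε))
  simp only [Finset.coe_univ, Set.preimage_univ, measure_univ] at this
  rw [← this]
  refine Finset.sum_congr rfl fun ε _ => ?_
  congr 1 with ω
  exact funext_iff.symm

/-- The weighted partition sum `∑ m(I_ε) ^ (1 + s) exp (s w(ε_n))` over the words of length
`n + 1`. -/
noncomputable def weightedSum (m : Measure ℝ) (w : Fin ℓ → ℝ) (n : ℕ) (s : ℝ) : ℝ :=
  ∑ ε : Fin (n + 1) → Fin ℓ,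
    pow₀ (m.real (adicInterval ε)) (1 + s) * Real.exp (s * w (ε (Fin.last n)))

/-- By the Markov property, summing over the last letter leaves a moment of the row of the letter
before it. -/
theorem IsMarkovChain.weightedSum_succ [IsProbabilityMeasure Pr]
    (hX : IsMarkovChain Pr X p P) (hdeg : ∀ i j, P i j ≠ 1) (w : Fin ℓ → ℝ) (n : ℕ) (s : ℝ) :
    weightedSum (drivenMeasure Pr X) w (n + 1) s
      = ∑ ε : Fin (n + 1) → Fin ℓ,
          pow₀ ((drivenMeasure Pr X).real (adicInterval ε)) (1 + s) *
            ∑ j, pow₀ (P (ε (Fin.last n)) j) (1 + s) * Real.exp (s * w j) := by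
  have hP := Matrix.mem_rowStochastic_iff_sum.1 hX.matrix_mem
  rw [weightedSum, ← (Fin.snocEquiv fun _ => Fin ℓ).sum_comp, Fintype.sum_prod_type,
    Finset.sum_comm]
  refine Finset.sum_congr rfl fun ε _ => ?_
  rw [Finset.mul_sum]
  refine Finset.sum_congr rfl fun j _ => ?_
  have e1 : (Fin.snocEquiv fun _ => Fin ℓ) (j, ε) = (Fin.snoc ε j : Fin (n + 2) → Fin ℓ) := rfl
  rw [e1, hX.real_adicInterval_snoc hdeg, Fin.snoc_last,
    pow₀_mul measureReal_nonneg (hP.1 _ _), mul_assoc]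

theorem IsMarkovChain.partitionSum_pos [IsProbabilityMeasure Pr]
    (hX : IsMarkovChain Pr X p P) (hdeg : ∀ i j, P i j ≠ 1) (n : ℕ) (q : ℝ) :
    0 < partitionSum ℓ (drivenMeasure Pr X) n q := by
  have := isProbabilityMeasure_drivenMeasure hX
  obtain ⟨ε, -, hε⟩ : ∃ ε ∈ Finset.univ, drivenMeasure Pr X (adicInterval (n := n) ε) ≠ 0 := by
    by_contra! hcon
    have := hX.sum_real_adicInterval hdeg n
    rw [Finset.sum_eq_zero hcon] at this
    exact zero_ne_one this
  exact Finset.sum_pos' (fun _ _ => pow₀_nonneg measureReal_nonneg q) ⟨ε, Finset.mem_univ ε,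
    pow₀_pos (ENNReal.toReal_pos hε (measure_ne_top _ _)) q⟩

/-- If `|s w| ≤ W`, the weighted and the unweighted sums differ by a factor at most `exp W`. -/
theorem weightedSum_bounds (m : Measure ℝ) {w : Fin ℓ → ℝ} {s W : ℝ} (hW : ∀ i, |s * w i| ≤ W)
    (n : ℕ) :
    Real.exp (-W) * partitionSum ℓ m (n + 1) (1 + s) ≤ weightedSum m w n s ∧
      weightedSum m w n s ≤ Real.exp W * partitionSum ℓ m (n + 1) (1 + s) := by
  unfold weightedSum partitionSum
  rw [Finset.mul_sum, Finset.mul_sum]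
  constructor <;> refine Finset.sum_le_sum fun ε _ => ?_
  · rw [mul_comm]
    exact mul_le_mul_of_nonneg_left (Real.exp_le_exp.2 (neg_le_of_abs_le (hW _)))
      (pow₀_nonneg measureReal_nonneg _)
  · rw [mul_comm (Real.exp W)]
    exact mul_le_mul_of_nonneg_left (Real.exp_le_exp.2 (le_of_abs_le (hW _)))
      (pow₀_nonneg measureReal_nonneg _)

/-- The hypothesis on `w` says that every row moment has the same first order behaviour `exp (s (w i
- h))`. The factor `exp (s w i)` rebuilds the weighted sum of the previous order, so the errors add
up to at most `n δ |s|`. -/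
theorem IsMarkovChain.hasEntropy [IsProbabilityMeasure Pr]
    (hX : IsMarkovChain Pr X p P) (hdeg : ∀ i j, P i j ≠ 1) {w : Fin ℓ → ℝ} {h : ℝ}
    (hw : ∀ i, ∑ j, P i j * (Real.log (P i j) + w j) = w i - h) :
    HasEntropy ℓ (drivenMeasure Pr X) h := by
  intro δ hδ
  have hP := Matrix.mem_rowStochastic_iff_sum.1 hX.matrix_mem
  filter_upwards [eventually_all.2 fun i =>
    log_moment_isLittleO (hP.1 i) (hP.2 i) w (hw i) hδ] with s hs
  set S := fun n => partitionSum ℓ (drivenMeasure Pr X) n (1 + s) with hS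
  set T := fun n => weightedSum (drivenMeasure Pr X) w n s with hT
  set W := ∑ i, |s * w i| with hW
  have hWi : ∀ i, |s * w i| ≤ W := fun i =>
    Finset.single_le_sum (f := fun i => |s * w i|) (fun _ _ => abs_nonneg _) (Finset.mem_univ i)
  have hSpos : ∀ n, 0 < S n := fun n => hX.partitionSum_pos hdeg n _
  have hb := weightedSum_bounds (drivenMeasure Pr X) hWi
  have hTpos : ∀ n, 0 < T n := fun n =>
    (mul_pos (Real.exp_pos _) (hSpos (n + 1))).trans_le (hb n).1
  have hST : ∀ n, |Real.log (S (n + 1)) - Real.log (T n)| ≤ W := by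
    intro n
    have h1 := Real.log_le_log (mul_pos (Real.exp_pos _) (hSpos (n + 1))) (hb n).1
    have h2 := Real.log_le_log (hTpos n) (hb n).2
    rw [Real.log_mul (Real.exp_pos _).ne' (hSpos _).ne', Real.log_exp] at h1 h2
    exact abs_le.2 ⟨by linarith, by linarith⟩
  have hstep : ∀ n, |Real.log (T (n + 1)) - Real.log (T n) + s * h| ≤ δ * |s| := by
    intro n
    have hrow : ∀ i, Real.exp (-(s * h) - δ * |s|) * Real.exp (s * w i)
          ≤ ∑ j, pow₀ (P i j) (1 + s) * Real.exp (s * w j) ∧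
        ∑ j, pow₀ (P i j) (1 + s) * Real.exp (s * w j)
          ≤ Real.exp (-(s * h) + δ * |s|) * Real.exp (s * w i) := by
      intro i
      obtain ⟨h0, h1⟩ := hs i
      rw [abs_le] at h1
      rw [← Real.exp_add, ← Real.exp_add, ← Real.le_log_iff_exp_le h0,
        ← Real.log_le_iff_le_exp h0]
      constructor <;> linarith [h1.1, h1.2]
    have h1 : Real.exp (-(s * h) - δ * |s|) * T n ≤ T (n + 1) := by
      simp only [hT]
      rw [hX.weightedSum_succ hdeg, weightedSum, Finset.mul_sum]
      refine Finset.sum_le_sum fun ε _ => ?_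
      rw [mul_left_comm]
      exact mul_le_mul_of_nonneg_left (hrow _).1 (pow₀_nonneg measureReal_nonneg _)
    have h2 : T (n + 1) ≤ Real.exp (-(s * h) + δ * |s|) * T n := by
      simp only [hT]
      rw [hX.weightedSum_succ hdeg, weightedSum, Finset.mul_sum]
      refine Finset.sum_le_sum fun ε _ => ?_
      rw [mul_left_comm (Real.exp _)]
      exact mul_le_mul_of_nonneg_left (hrow _).2 (pow₀_nonneg measureReal_nonneg _)
    replace h1 := Real.log_le_log (mul_pos (Real.exp_pos _) (hTpos n)) h1
    replace h2 := Real.log_le_log (hTpos (n + 1)) h2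
    rw [Real.log_mul (Real.exp_pos _).ne' (hTpos _).ne', Real.log_exp] at h1 h2
    exact abs_le.2 ⟨by linarith, by linarith⟩
  have hiter : ∀ n : ℕ, |Real.log (T n) - Real.log (T 0) + n * (s * h)| ≤ n * (δ * |s|) := by
    intro n
    induction n with
    | zero => simp
    | succ n ih =>
      have := hstep n
      rw [abs_le] at ih this ⊢
      push_cast
      constructor <;> linarith [ih.1, ih.2, this.1, this.2]
  -- `T n` involves words of length `n + 1`: the shift costs `|s * h|`, removing the weights costs
  -- `W`, and the last term covers order `0`.
  refine ⟨|Real.log (T 0)| + W + |s * h| + |Real.log (S 0)|, fun n => ⟨hSpos n, ?_⟩⟩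
  have hW0 : 0 ≤ W := Finset.sum_nonneg fun _ _ => abs_nonneg _
  have hδs : 0 ≤ δ * |s| := by positivity
  have a1 := abs_nonneg (Real.log (T 0))
  have a2 := abs_nonneg (s * h)
  have a3 := abs_nonneg (Real.log (S 0))
  change |Real.log (S n) + n * (s * h)| ≤ _
  cases n with
  | zero => simp only [Nat.cast_zero, zero_mul, add_zero, zero_add]; linarith
  | succ n =>
    have b1 := abs_le.1 (hST n)
    have b2 := abs_le.1 (hiter n)
    have b3 := abs_le.1 (le_refl |Real.log (T 0)|)
    have b4 := abs_le.1 (le_refl |s * h|)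
    push_cast
    refine abs_le.2 ⟨?_, ?_⟩ <;> linarith [b1.1, b1.2, b2.1, b2.2, b3.1, b3.2, b4.1, b4.2]

/-- The measure driven by an irreducible Markov chain has a nonnegative entropy. -/
theorem IsMarkovChain.exists_hasEntropy [IsProbabilityMeasure Pr]
    (hX : IsMarkovChain Pr X p P) (hdeg : ∀ i j, P i j ≠ 1) (hirr : P.IsIrreducible) :
    ∃ h, 0 ≤ h ∧ HasEntropy ℓ (drivenMeasure Pr X) h := by
  have hP := Matrix.mem_rowStochastic_iff_sum.1 hX.matrix_mem
  have : Nonempty (Fin ℓ) := ⟨⟨0, hX.pos⟩⟩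
  obtain ⟨h, u, hu⟩ := exists_poisson hP.2 hirr fun i => ∑ j, Real.negMulLog (P i j)
  refine ⟨h, poisson_const_nonneg hP.2 hP.1 (fun i => Finset.sum_nonneg fun j _ =>
    Real.negMulLog_nonneg (hP.1 i j) (Matrix.le_one_of_mem_rowStochastic hX.matrix_mem)) hu,
    hX.hasEntropy hdeg (w := fun i => -u i) fun i => ?_⟩
  have := hu i
  simp only [Real.negMulLog, neg_mul, Finset.sum_neg_distrib] at this
  simp only [mul_add, mul_neg, Finset.sum_add_distrib, Finset.sum_neg_distrib]
  linarith

end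

/-! ### Consequences of the entropy: derivative of `τ` and local exponents. -/

section Entropy

variable {ℓ : ℕ} {m : Measure ℝ} {h : ℝ}

theorem HasEntropy.abs_structureFunction_le (hm : HasEntropy ℓ m h) (hℓ : 1 < ℓ) {δ : ℝ}
    (hδ : 0 < δ) :
    ∀ᶠ s in 𝓝 (0 : ℝ), |structureFunction ℓ m (1 + s) + s * (h / Real.log ℓ)| ≤ δ * |s| := by
  have hL : 0 < Real.log ℓ := Real.log_pos (by exact_mod_cast hℓ)
  filter_upwards [hm (δ * Real.log ℓ) (by positivity)] with s hs
  obtain ⟨K, hK⟩ := hs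
  set L := Real.log ℓ with hLdef
  set a := fun n : ℕ => 1 / ((n : ℝ) * L) * Real.log (partitionSum ℓ m n (1 + s)) with ha
  have hτ : structureFunction ℓ m (1 + s) = limsup a atTop := rfl
  have hlim : Tendsto (fun n : ℕ => K / L / (n : ℝ)) atTop (𝓝 0) :=
    tendsto_const_div_atTop_nhds_zero_nat _
  have hev : ∀ η > 0, ∀ᶠ n in atTop, -(s * (h / L)) - δ * |s| - η ≤ a n ∧
      a n ≤ -(s * (h / L)) + δ * |s| + η := by
    intro η hη
    filter_upwards [hlim.eventually_lt_const hη, eventually_gt_atTop 0] with n hn hn0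
    have hn' : (0 : ℝ) < n := by exact_mod_cast hn0
    have h1 := abs_le.1 (hK n).2
    have hKη : K ≤ n * L * η := by
      rw [div_div, div_lt_iff₀ (by positivity)] at hn
      linarith
    simp only [ha]
    rw [one_div_mul_eq_div, le_div_iff₀ (by positivity), div_le_iff₀ (by positivity)]
    have e1 : s * (h / L) * (n * L) = n * (s * h) := by field_simp
    constructor <;> nlinarith [h1.1, h1.2]
  -- A real `limsup` is meaningful only for bounded sequences, hence both bounds.
  have hbdd : IsBoundedUnder (· ≤ ·) atTop a :=
    ⟨_, (eventually_map.2 ((hev 1 one_pos).mono fun _ hn => hn.2))⟩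
  have hbdd' : IsBoundedUnder (· ≥ ·) atTop a :=
    ⟨_, (eventually_map.2 ((hev 1 one_pos).mono fun _ hn => hn.1))⟩
  have hup : limsup a atTop ≤ -(s * (h / L)) + δ * |s| :=
    le_of_forall_pos_le_add fun η hη =>
      limsup_le_of_le hbdd'.isCoboundedUnder_le ((hev η hη).mono fun _ hn => hn.2)
  have hlow : -(s * (h / L)) - δ * |s| ≤ limsup a atTop := by
    refine le_of_forall_pos_le_add fun η hη => ?_
    have := le_limsup_of_frequently_le ((hev η hη).mono fun _ hn => hn.1).frequently hbdd
    linarith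
  rw [hτ]
  exact abs_le.2 ⟨by linarith, by linarith⟩

theorem HasEntropy.hasDerivAt_structureFunction (hm : HasEntropy ℓ m h) (hℓ : 1 < ℓ) :
    HasDerivAt (structureFunction ℓ m) (-(h / Real.log ℓ)) 1 := by
  -- The estimate holds at `s = 0` itself, where its right side vanishes.
  have h1 : structureFunction ℓ m 1 = 0 := by
    simpa using (hm.abs_structureFunction_le hℓ one_pos).self_of_nhds
  rw [hasDerivAt_iff_isLittleO_nhds_zero, Asymptotics.isLittleO_iff]
  intro δ hδ
  filter_upwards [hm.abs_structureFunction_le hℓ hδ] with s hs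
  simpa [h1] using hs

/-- Chernoff's bound: families of words selected by an exponential condition of rate `c ≠ h` have
summable measures, hence almost every point avoids them eventually. -/
theorem HasEntropy.ae_eventually_not [IsFiniteMeasure m] (hm : HasEntropy ℓ m h) {c σ : ℝ}
    (hσ : 0 < σ * (h - c)) (Q : ∀ n, (Fin n → Fin ℓ) → Prop)
    (hQ : ∀ s, 0 < s * σ → ∀ n ε, Q n ε → m.real (adicInterval ε) ≤
      pow₀ (m.real (adicInterval ε)) (1 + s) * Real.exp (n * (c * s))) :
    ∀ᵐ x ∂m, ∀ᶠ n in atTop, ∀ ε : Fin n → Fin ℓ, x ∈ adicInterval ε → ¬ Q n ε := by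
  classical
  have hhc : h - c ≠ 0 := by rintro H; simp [H] at hσ
  have hev := hm (|h - c| / 2) (by positivity)
  -- Take `s = r * σ` with `r > 0` small; only the sign of `σ` matters, and it makes `s * (h - c)`
  -- positive.
  obtain ⟨s, ⟨K, hK⟩, hs⟩ : ∃ s, (∃ K, ∀ n : ℕ, 0 < partitionSum ℓ m n (1 + s) ∧
      |Real.log (partitionSum ℓ m n (1 + s)) + n * (s * h)| ≤ n * (|h - c| / 2 * |s|) + K) ∧
      0 < s * σ := by
    have hσ0 : σ ≠ 0 := by rintro rfl; simp at hσ
    have ht : Tendsto (fun r : ℝ => r * σ) (𝓝[>] 0) (𝓝 0) := by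
      have : Tendsto (fun r : ℝ => r * σ) (𝓝 0) (𝓝 (0 * σ)) := tendsto_id.mul_const σ
      rw [zero_mul] at this
      exact this.mono_left nhdsWithin_le_nhds
    obtain ⟨r, hr, hr0⟩ := ((ht.eventually hev).and self_mem_nhdsWithin).exists
    refine ⟨r * σ, hr, ?_⟩
    rw [mul_assoc]
    exact mul_pos hr0 (mul_self_pos.2 hσ0)
  have hsc : 0 < s * (h - c) := by
    have : 0 < (s * σ) * (σ * (h - c)) := mul_pos hs hσ
    have e : (s * σ) * (σ * (h - c)) = σ ^ 2 * (s * (h - c)) := by ring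
    rw [e] at this
    exact pos_of_mul_pos_right this (sq_nonneg σ)
  -- The gain per letter is `s * (h - c) = 2 * ρ`; the tolerance `|h - c| / 2` spends half of it,
  -- and the remaining `ρ` gives a geometric series.
  set ρ := |h - c| / 2 * |s| with hρ
  have hρ' : s * (h - c) = 2 * ρ := by
    rw [hρ, ← abs_of_pos hsc, abs_mul]; ring
  have hρ0 : 0 < ρ := by linarith
  have hsum : ∀ n, ∑ ε : Fin n → Fin ℓ with Q n ε, m.real (adicInterval ε)
      ≤ Real.exp K * Real.exp (-ρ) ^ n := by
    intro n
    have hS := (hK n).1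
    calc ∑ ε : Fin n → Fin ℓ with Q n ε, m.real (adicInterval ε)
        ≤ ∑ ε : Fin n → Fin ℓ with Q n ε,
            pow₀ (m.real (adicInterval ε)) (1 + s) * Real.exp (n * (c * s)) :=
          Finset.sum_le_sum fun ε hε => hQ s hs n ε (Finset.mem_filter.1 hε).2
      _ ≤ ∑ ε : Fin n → Fin ℓ,
            pow₀ (m.real (adicInterval ε)) (1 + s) * Real.exp (n * (c * s)) :=
          Finset.sum_le_sum_of_subset_of_nonneg (Finset.filter_subset _ _) fun ε _ _ =>
            mul_nonneg (pow₀_nonneg measureReal_nonneg _) (Real.exp_pos _).le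
      _ = partitionSum ℓ m n (1 + s) * Real.exp (n * (c * s)) := by
          rw [← Finset.sum_mul]; rfl
      _ = Real.exp (Real.log (partitionSum ℓ m n (1 + s)) + n * (c * s)) := by
          rw [Real.exp_add, Real.exp_log hS]
      _ ≤ Real.exp K * Real.exp (-ρ) ^ n := by
          rw [← Real.exp_nat_mul, ← Real.exp_add]
          refine Real.exp_le_exp.2 ?_
          have := le_of_abs_le (hK n).2
          have e : (n : ℝ) * (s * h) - n * (c * s) = n * (2 * ρ) := by rw [← hρ']; ring
          linarith
  have hBC : ∑' n, m (⋃ ε ∈ Finset.univ.filter (Q n), adicInterval ε) ≠ ∞ := by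
    have hle : ∀ n, m (⋃ ε ∈ Finset.univ.filter (Q n), adicInterval ε)
        ≤ ENNReal.ofReal (Real.exp K * Real.exp (-ρ) ^ n) := by
      intro n
      refine (measure_biUnion_finset_le _ _).trans ?_
      refine le_trans (le_of_eq ?_) (ENNReal.ofReal_le_ofReal (hsum n))
      rw [ENNReal.ofReal_sum_of_nonneg fun _ _ => measureReal_nonneg]
      exact Finset.sum_congr rfl fun ε _ => (ofReal_measureReal (measure_ne_top _ _)).symm
    refine ne_top_of_le_ne_top ?_ (ENNReal.tsum_le_tsum hle)
    exact ((summable_geometric_of_lt_one (Real.exp_pos _).le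
      (Real.exp_lt_one_iff.2 (by linarith))).mul_left _).tsum_ofReal_ne_top
  filter_upwards [ae_eventually_notMem hBC] with x hx
  filter_upwards [hx] with n hn ε hxε hε
  exact hn (Set.mem_biUnion (Finset.mem_coe.2 (Finset.mem_filter.2 ⟨Finset.mem_univ ε, hε⟩)) hxε)

/-- Here `s > 0`: on a bad interval `m(I) ^ s * exp (n c s) ≥ 1`. The opposite bound below uses `s <
0`. -/
theorem HasEntropy.ae_eventually_lt_exp [IsFiniteMeasure m] (hm : HasEntropy ℓ m h) {c : ℝ}
    (hc : c < h) : ∀ᵐ x ∂m, ∀ᶠ n : ℕ in atTop, ∀ ε : Fin n → Fin ℓ, x ∈ adicInterval ε →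
      m.real (adicInterval ε) < Real.exp (-(n * c)) := by
  have := hm.ae_eventually_not (c := c) (σ := 1) (by linarith)
    (fun n ε => Real.exp (-(n * c)) ≤ m.real (adicInterval ε)) ?_
  · simpa only [not_le] using this
  · intro s hs n ε hε
    rw [mul_one] at hs
    have h0 := (Real.exp_pos _).trans_le hε
    rw [pow₀, if_neg h0.ne', Real.rpow_add h0, Real.rpow_one, mul_assoc]
    refine le_mul_of_one_le_right h0.le ?_
    rw [Real.rpow_def_of_pos h0, ← Real.exp_add]
    refine Real.one_le_exp ?_
    have := (Real.le_log_iff_exp_le h0).2 hε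
    nlinarith

theorem HasEntropy.ae_eventually_exp_lt [IsFiniteMeasure m] (hm : HasEntropy ℓ m h) {c : ℝ}
    (hc : h < c) : ∀ᵐ x ∂m, ∀ᶠ n : ℕ in atTop, ∀ ε : Fin n → Fin ℓ, x ∈ adicInterval ε →
      Real.exp (-(n * c)) < m.real (adicInterval ε) := by
  have := hm.ae_eventually_not (c := c) (σ := -1) (by linarith)
    (fun n ε => m.real (adicInterval ε) ≤ Real.exp (-(n * c))) ?_
  · simpa only [not_le] using this
  · intro s hs n ε hε
    rcases (measureReal_nonneg (μ := m) (s := adicInterval ε)).eq_or_lt with h0 | h0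
    -- For negative exponents, null intervals do no harm thanks to the convention `0 ^ q = 0`.
    · simp [pow₀, ← h0]
    rw [pow₀, if_neg h0.ne', Real.rpow_add h0, Real.rpow_one, mul_assoc]
    refine le_mul_of_one_le_right h0.le ?_
    rw [Real.rpow_def_of_pos h0, ← Real.exp_add]
    refine Real.one_le_exp ?_
    have := (Real.log_le_iff_le_exp h0).2 hε
    nlinarith

end Entropy

/-! ### From local exponents to Hausdorff dimension. -/

section Dimension

variable {ℓ : ℕ} {m : Measure ℝ} {h : ℝ}

theorem measurableSet_adicInterval {n : ℕ} (ε : Fin n → Fin ℓ) :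
    MeasurableSet (adicInterval ε) :=
  measurableSet_Ico

theorem pairwiseDisjoint_adicInterval (hℓ : 0 < ℓ) {n : ℕ} (s : Set (Fin n → Fin ℓ)) :
    s.PairwiseDisjoint adicInterval := fun _ _ _ _ hne =>
  Set.disjoint_left.2 fun _ h₁ h₂ => hne (word_eq_of_mem hℓ h₁ h₂)

theorem volume_adicInterval {n : ℕ} (ε : Fin n → Fin ℓ) :
    volume (adicInterval ε) = ENNReal.ofReal (1 / (ℓ : ℝ) ^ n) := by
  rw [adicInterval, Real.volume_Ico, add_sub_cancel_left]

theorem ediam_adicInterval {n : ℕ} (ε : Fin n → Fin ℓ) :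
    Metric.ediam (adicInterval ε) = ENNReal.ofReal (1 / (ℓ : ℝ) ^ n) := by
  rw [adicInterval, Real.ediam_Ico, add_sub_cancel_left]

/-- The dictionary between the decay rate `c` of the measure and the dimension `c / log ℓ`. -/
theorem ofReal_one_div_pow_rpow (hℓ : 1 < ℓ) (n : ℕ) (c : ℝ) :
    ENNReal.ofReal (1 / (ℓ : ℝ) ^ n) ^ (c / Real.log ℓ) = ENNReal.ofReal (Real.exp (-(n * c))) := by
  have h0 : (0 : ℝ) < ℓ := by positivity
  have hL : 0 < Real.log ℓ := Real.log_pos (by exact_mod_cast hℓ)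
  have hp : (0 : ℝ) < 1 / (ℓ : ℝ) ^ n := by positivity
  rw [ENNReal.ofReal_rpow_of_pos hp, Real.rpow_def_of_pos hp, one_div, Real.log_inv, Real.log_pow]
  congr 2
  field_simp

theorem ae_forall_exists_mem_adicInterval [IsProbabilityMeasure m] (hℓ : 0 < ℓ)
    (hsum : ∀ n, ∑ ε : Fin n → Fin ℓ, m (adicInterval ε) = 1) :
    ∀ᵐ x ∂m, ∀ n, ∃ ε : Fin n → Fin ℓ, x ∈ adicInterval ε := by
  refine ae_all_iff.2 fun n => ?_
  have h1 : m (⋃ ε ∈ (Finset.univ : Finset (Fin n → Fin ℓ)), adicInterval ε) = 1 := by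
    rw [measure_biUnion_finset (pairwiseDisjoint_adicInterval hℓ _)
      fun ε _ => measurableSet_adicInterval ε, hsum]
  have h2 : MeasurableSet (⋃ ε ∈ (Finset.univ : Finset (Fin n → Fin ℓ)), adicInterval ε) :=
    Finset.measurableSet_biUnion _ fun ε _ => measurableSet_adicInterval ε
  have h3 := (prob_compl_eq_zero_iff h2).2 h1
  filter_upwards [compl_mem_ae_iff.2 h3] with x hx
  simpa using hx

/-- The points all of whose `ℓ`-adic intervals of order at least `N` have measure at least
`exp (-n c)` form a set of finite Hausdorff measure in dimension `c / log ℓ`. -/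
theorem hausdorffMeasure_le_one [IsProbabilityMeasure m] (hℓ : 1 < ℓ)
    (hsum : ∀ n, ∑ ε : Fin n → Fin ℓ, m (adicInterval ε) = 1) (c : ℝ) (N : ℕ) :
    μH[c / Real.log ℓ] {x : ℝ | ∀ n ≥ N, ∃ ε : Fin n → Fin ℓ,
      x ∈ adicInterval ε ∧ Real.exp (-(n * c)) < m.real (adicInterval ε)} ≤ 1 := by
  classical
  have hl : (1 : ℝ) < ℓ := by exact_mod_cast hℓ
  let ι : ℕ → Type := fun n =>
    {ε : Fin n → Fin ℓ // Real.exp (-(n * c)) < m.real (adicInterval ε)}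
  have : ∀ n, Fintype (ι n) := fun n => inferInstanceAs (Fintype
    {ε : Fin n → Fin ℓ // Real.exp (-(n * c)) < m.real (adicInterval ε)})
  have hr : Tendsto (fun n : ℕ => ENNReal.ofReal (1 / (ℓ : ℝ) ^ n)) atTop (𝓝 0) := by
    rw [← ENNReal.ofReal_zero]
    refine ENNReal.tendsto_ofReal ?_
    simp only [← one_div_pow]
    exact tendsto_pow_atTop_nhds_zero_of_lt_one (by positivity)
      ((div_lt_one (by positivity)).2 hl)
  refine (Measure.hausdorffMeasure_le_liminf_sum (c / Real.log ℓ) _ _ hr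
    (fun n (ε : ι n) => adicInterval ε.1) (Eventually.of_forall fun n ε =>
      (ediam_adicInterval _).le) ?_).trans ?_
  · filter_upwards [eventually_ge_atTop N] with n hn x hx
    obtain ⟨ε, hε, hε'⟩ := hx n hn
    exact Set.mem_iUnion.2 ⟨⟨ε, hε'⟩, hε⟩
  · have hle : ∀ n, ∑ ε : ι n, Metric.ediam (adicInterval ε.1) ^ (c / Real.log ℓ) ≤ 1 := by
      intro n
      simp only [ediam_adicInterval, ofReal_one_div_pow_rpow hℓ]
      calc ∑ _ε : ι n, ENNReal.ofReal (Real.exp (-(n * c)))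
          ≤ ∑ ε : ι n, m (adicInterval ε.1) := Finset.sum_le_sum fun ε _ => by
            rw [← ofReal_measureReal (measure_ne_top m (adicInterval ε.1))]
            exact ENNReal.ofReal_le_ofReal ε.2.le
        _ = ∑ ε ∈ Finset.univ.image (Subtype.val : ι n → _), m (adicInterval ε) := by
            rw [Finset.sum_image fun _ _ _ _ => Subtype.ext]
        _ ≤ ∑ ε : Fin n → Fin ℓ, m (adicInterval ε) :=
            Finset.sum_le_sum_of_subset (Finset.subset_univ _)
        _ = 1 := hsum n
    refine (liminf_le_liminf (Eventually.of_forall hle)).trans ?_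
    simp

theorem HasEntropy.upperDim_le_of_lt [IsProbabilityMeasure m] (hm : HasEntropy ℓ m h)
    (hℓ : 1 < ℓ) (hsum : ∀ n, ∑ ε : Fin n → Fin ℓ, m (adicInterval ε) = 1) {c : ℝ} (hc : h < c)
    (hc0 : 0 ≤ c) : upperDim m ≤ ENNReal.ofReal (c / Real.log ℓ) := by
  have hL : 0 < Real.log ℓ := Real.log_pos (by exact_mod_cast hℓ)
  let E : ℕ → Set ℝ := fun N => {x : ℝ | ∀ n ≥ N, ∃ ε : Fin n → Fin ℓ,
      x ∈ adicInterval ε ∧ Real.exp (-(n * c)) < m.real (adicInterval ε)}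
  have hE : ∀ᵐ x ∂m, x ∈ ⋃ N, E N := by
    filter_upwards [hm.ae_eventually_exp_lt hc,
      ae_forall_exists_mem_adicInterval (by omega) hsum] with x h1 h2
    obtain ⟨N, hN⟩ := eventually_atTop.1 h1
    refine Set.mem_iUnion.2 ⟨N, fun n hn => ?_⟩
    obtain ⟨ε, hε⟩ := h2 n
    exact ⟨ε, hε, hN n hn ε hε⟩
  have hdim : dimH (⋃ N, E N) ≤ ENNReal.ofReal (c / Real.log ℓ) := by
    rw [dimH_iUnion]
    refine iSup_le fun N => dimH_le_of_hausdorffMeasure_ne_top ?_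
    rw [Real.coe_toNNReal _ (by positivity)]
    exact ne_top_of_le_ne_top ENNReal.one_ne_top (hausdorffMeasure_le_one hℓ hsum c N)
  -- To avoid proving `⋃ N, E N` measurable, remove a measurable null set containing its complement.
  obtain ⟨F, hFE, hF, hF0⟩ := exists_measurable_superset_of_null (mem_ae_iff.1 hE)
  refine (iInf₂_le_of_le Fᶜ hF.compl (iInf_le _ ((prob_compl_eq_one_iff hF).2 hF0))).trans ?_
  exact (dimH_mono (Set.compl_subset_comm.1 hFE)).trans hdim

theorem HasEntropy.upperDim_le [IsProbabilityMeasure m] (hm : HasEntropy ℓ m h)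
    (hℓ : 1 < ℓ) (hsum : ∀ n, ∑ ε : Fin n → Fin ℓ, m (adicInterval ε) = 1) (hh : 0 ≤ h) :
    upperDim m ≤ ENNReal.ofReal (h / Real.log ℓ) := by
  have ht : Tendsto (fun c => ENNReal.ofReal (c / Real.log ℓ)) (𝓝[>] h)
      (𝓝 (ENNReal.ofReal (h / Real.log ℓ))) :=
    ENNReal.tendsto_ofReal ((tendsto_id.div_const _).mono_left nhdsWithin_le_nhds)
  refine ge_of_tendsto ht ?_
  filter_upwards [self_mem_nhdsWithin] with c hc
  exact hm.upperDim_le_of_lt hℓ hsum hc (hh.trans (le_of_lt hc))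

/-- If `m` gives measure at most `exp (-n c)` to the intervals of order `n` that meet `F`, it gives
measure at most `4 exp (-n c)` to the part of `F` in a set of diameter at most `ℓ ^ (-n)`. -/
theorem measure_inter_le_of_ediam_le [IsFiniteMeasure m] (hℓ : 1 < ℓ) {F : Set ℝ} {n : ℕ} {c : ℝ}
    (hF : ∀ x ∈ F, ∃ ε : Fin n → Fin ℓ,
      x ∈ adicInterval ε ∧ m.real (adicInterval ε) < Real.exp (-(n * c)))
    {s : Set ℝ} (hs : Metric.ediam s ≤ ENNReal.ofReal (1 / (ℓ : ℝ) ^ n)) :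
    m (s ∩ F) ≤ 4 * ENNReal.ofReal (Real.exp (-(n * c))) := by
  classical
  rcases s.eq_empty_or_nonempty with rfl | ⟨a, ha⟩
  · simp
  have hl : (0 : ℝ) < ℓ := by positivity
  set r := 1 / (ℓ : ℝ) ^ n with hr
  have hr0 : 0 < r := by positivity
  set A := Finset.univ.filter fun ε : Fin n → Fin ℓ =>
    (s ∩ adicInterval ε).Nonempty ∧ m.real (adicInterval ε) < Real.exp (-(n * c)) with hA
  have hdist : ∀ y ∈ s, |y - a| ≤ r := by
    intro y hy
    have := (Metric.edist_le_ediam_of_mem hy ha).trans hs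
    rwa [edist_dist, ENNReal.ofReal_le_ofReal_iff hr0.le, Real.dist_eq] at this
  -- Intervals of length `r` meeting `s` lie within `2 * r` of `a`; being disjoint in length `4 *
  -- r`, they number at most `4`.
  have hsub : ⋃ ε ∈ A, adicInterval ε ⊆ Set.Icc (a - 2 * r) (a + 2 * r) := by
    refine Set.iUnion₂_subset fun ε hε x hx => ?_
    obtain ⟨y, hys, hy⟩ := (Finset.mem_filter.1 hε).2.1
    have h1 := abs_le.1 (hdist y hys)
    simp only [adicInterval, Set.mem_Ico, ← hr] at hx hy
    exact ⟨by linarith [h1.1], by linarith [h1.2]⟩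
  have hcard : (A.card : ℝ≥0∞) ≤ 4 := by
    have h1 := measure_mono (μ := volume) hsub
    rw [measure_biUnion_finset (pairwiseDisjoint_adicInterval (by omega) _)
      fun ε _ => measurableSet_adicInterval ε, Real.volume_Icc] at h1
    simp only [volume_adicInterval, Finset.sum_const, nsmul_eq_mul, ← hr] at h1
    have e : a + 2 * r - (a - 2 * r) = 4 * r := by ring
    rw [e, ENNReal.ofReal_mul (by norm_num)] at h1
    have e4 : ENNReal.ofReal 4 = 4 := by norm_num
    rw [e4] at h1
    exact (ENNReal.mul_le_mul_iff_left (ENNReal.ofReal_pos.2 hr0).ne' ENNReal.ofReal_ne_top).1 h1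
  have hcover : s ∩ F ⊆ ⋃ ε ∈ A, adicInterval ε := by
    rintro x ⟨hxs, hxF⟩
    obtain ⟨ε, hε, hε'⟩ := hF x hxF
    exact Set.mem_biUnion (Finset.mem_coe.2 (Finset.mem_filter.2
      ⟨Finset.mem_univ ε, ⟨x, hxs, hε⟩, hε'⟩)) hε
  calc m (s ∩ F) ≤ ∑ ε ∈ A, m (adicInterval ε) :=
        (measure_mono hcover).trans (measure_biUnion_finset_le _ _)
    _ ≤ ∑ _ε ∈ A, ENNReal.ofReal (Real.exp (-(n * c))) := Finset.sum_le_sum fun ε hε => by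
        rw [← ofReal_measureReal (measure_ne_top m (adicInterval ε))]
        exact ENNReal.ofReal_le_ofReal (Finset.mem_filter.1 hε).2.2.le
    _ = A.card * ENNReal.ofReal (Real.exp (-(n * c))) := by simp
    _ ≤ _ := by gcongr

/-- The mass distribution principle for `ℓ`-adic intervals. -/
theorem hausdorffMeasure_ne_zero [IsFiniteMeasure m] (hℓ : 1 < ℓ) {F : Set ℝ} {N : ℕ}
    {c : ℝ} (hc : 0 < c) (hF : ∀ x ∈ F, ∀ n ≥ N, ∃ ε : Fin n → Fin ℓ,
      x ∈ adicInterval ε ∧ m.real (adicInterval ε) < Real.exp (-(n * c)))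
    (hmF : m F ≠ 0) : μH[c / Real.log ℓ] F ≠ 0 := by
  have hl : (1 : ℝ) < ℓ := by exact_mod_cast hℓ
  have hL : 0 < Real.log ℓ := Real.log_pos hl
  have ht : 0 < c / Real.log ℓ := by positivity
  -- `4` counts the intervals; `exp c` pays for the gap of one order when the diameter lies between
  -- `ℓ ^ (-(n + 1))` and `ℓ ^ (-n)`.
  set k : ℝ≥0∞ := 4 * ENNReal.ofReal (Real.exp c) with hk
  have hk0 : k ≠ 0 := mul_ne_zero (by norm_num) (ENNReal.ofReal_pos.2 (Real.exp_pos c)).ne'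
  have hktop : k ≠ ∞ := ENNReal.mul_ne_top (by norm_num) ENNReal.ofReal_ne_top
  have hN0 : (0 : ℝ) < 1 / (ℓ : ℝ) ^ N := by positivity
  have key : ∀ s : Set ℝ, Metric.ediam s ≤ ENNReal.ofReal (1 / (ℓ : ℝ) ^ N) →
      m (s ∩ F) ≤ k * Metric.ediam s ^ (c / Real.log ℓ) := by
    intro s hs
    have hle : ∀ n ≥ N, Metric.ediam s ≤ ENNReal.ofReal (1 / (ℓ : ℝ) ^ n) →
        m (s ∩ F) ≤ 4 * ENNReal.ofReal (Real.exp (-(n * c))) := fun n hn hs' =>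
      measure_inter_le_of_ediam_le hℓ (fun x hx => hF x hx n hn) hs'
    -- A set of diameter `0` has no such `n`, but the bound then holds at every order `n ≥ N` and
    -- tends to `0`.
    rcases eq_or_ne (Metric.ediam s) 0 with h0 | h0
    · rw [h0, ENNReal.zero_rpow_of_pos ht, mul_zero]
      have hlim : Tendsto (fun n : ℕ => 4 * ENNReal.ofReal (Real.exp (-(n * c)))) atTop
          (𝓝 (4 * ENNReal.ofReal 0)) := by
        refine ENNReal.Tendsto.const_mul (ENNReal.tendsto_ofReal ?_) (Or.inr (by norm_num))
        exact Real.tendsto_exp_neg_atTop_nhds_zero.comp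
          (tendsto_natCast_atTop_atTop.atTop_mul_const hc)
      rw [ENNReal.ofReal_zero, mul_zero] at hlim
      refine ge_of_tendsto hlim ?_
      filter_upwards [eventually_ge_atTop N] with n hn
      exact hle n hn (by rw [h0]; exact zero_le)
    · have htop : Metric.ediam s ≠ ∞ := ne_top_of_le_ne_top ENNReal.ofReal_ne_top hs
      set D := (Metric.ediam s).toReal with hD
      have hDs : ENNReal.ofReal D = Metric.ediam s := ENNReal.ofReal_toReal htop
      have hD0 : 0 < D := ENNReal.toReal_pos h0 htop
      rw [← hDs, ENNReal.ofReal_le_ofReal_iff hN0.le] at hs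
      have hlinv : 1 / (ℓ : ℝ) < 1 := (div_lt_one (by positivity)).2 hl
      obtain ⟨n, hn1, hn2⟩ := exists_nat_pow_near_of_lt_one (x := D) (y := 1 / (ℓ : ℝ)) hD0
        (hs.trans (by rw [← one_div_pow]; exact pow_le_one₀ (by positivity) hlinv.le))
        (by positivity) hlinv
      have hnN : N ≤ n := by
        by_contra! hlt
        have := pow_le_pow_of_le_one (by positivity : 0 ≤ 1 / (ℓ : ℝ)) hlinv.le
          (Nat.succ_le_of_lt hlt)
        rw [one_div_pow _ N] at this
        exact absurd (hn1.trans_le hs) (not_lt.2 this)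
      rw [one_div_pow] at hn1 hn2
      refine (hle n hnN (by rw [← hDs]; exact ENNReal.ofReal_le_ofReal hn2)).trans ?_
      rw [hk, mul_assoc]
      gcongr
      have h1 : ENNReal.ofReal (1 / (ℓ : ℝ) ^ (n + 1)) ^ (c / Real.log ℓ)
          ≤ Metric.ediam s ^ (c / Real.log ℓ) := by
        rw [← hDs]
        exact ENNReal.rpow_le_rpow (ENNReal.ofReal_le_ofReal hn1.le) ht.le
      rw [ofReal_one_div_pow_rpow hℓ] at h1
      refine le_trans (le_of_eq ?_) (mul_le_mul_right h1 _)
      rw [← ENNReal.ofReal_mul (Real.exp_pos c).le, ← Real.exp_add]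
      congr 2
      push_cast
      ring
  have hle : k⁻¹ • m.restrict F ≤ μH[c / Real.log ℓ] := by
    refine Measure.le_hausdorffMeasure _ _ _ (ENNReal.ofReal_pos.2 hN0) fun s hs => ?_
    -- The closure has the same diameter and is measurable, so `m.restrict F` can be evaluated on it
    -- with `F` arbitrary.
    have h1 := key (closure s) (by rwa [Metric.ediam_closure])
    rw [Metric.ediam_closure] at h1
    rw [Measure.smul_apply, smul_eq_mul, ← ENNReal.div_eq_inv_mul]
    refine ENNReal.div_le_of_le_mul' ((measure_mono subset_closure).trans ?_)
    rwa [Measure.restrict_apply isClosed_closure.measurableSet]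
  intro h0
  have h1 := hle F
  rw [h0, Measure.smul_apply, Measure.restrict_apply_self, smul_eq_mul, nonpos_iff_eq_zero,
    mul_eq_zero] at h1
  exact h1.elim (ENNReal.inv_ne_zero.2 hktop) hmF

/-- The sets `F N` exhaust almost all of `E`, so one of them has positive measure and the mass
distribution principle applies to it. -/
theorem HasEntropy.le_lowerDim_of_lt [IsProbabilityMeasure m] (hm : HasEntropy ℓ m h)
    (hℓ : 1 < ℓ) (hsum : ∀ n, ∑ ε : Fin n → Fin ℓ, m (adicInterval ε) = 1) {c : ℝ} (hc : c < h) :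
    ENNReal.ofReal (c / Real.log ℓ) ≤ lowerDim m := by
  have hL : 0 < Real.log ℓ := Real.log_pos (by exact_mod_cast hℓ)
  rcases le_or_gt c 0 with hc0 | hc0
  · rw [ENNReal.ofReal_of_nonpos (div_nonpos_of_nonpos_of_nonneg hc0 hL.le)]
    exact zero_le
  refine le_iInf fun E => le_iInf fun _ => le_iInf fun hE => ?_
  let F : ℕ → Set ℝ := fun N => {x ∈ E | ∀ n ≥ N, ∃ ε : Fin n → Fin ℓ,
      x ∈ adicInterval ε ∧ m.real (adicInterval ε) < Real.exp (-(n * c))}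
  have hEF : E ≤ᵐ[m] ⋃ N, F N := by
    filter_upwards [hm.ae_eventually_lt_exp hc,
      ae_forall_exists_mem_adicInterval (by omega) hsum] with x h1 h2 hx
    obtain ⟨N, hN⟩ := eventually_atTop.1 h1
    refine Set.mem_iUnion.2 ⟨N, hx, fun n hn => ?_⟩
    obtain ⟨ε, hε⟩ := h2 n
    exact ⟨ε, hε, hN n hn ε hε⟩
  obtain ⟨N, hN⟩ := exists_measure_pos_of_not_measure_iUnion_null
    (hE.trans_le (measure_mono_ae hEF)).ne'
  have h1 := hausdorffMeasure_ne_zero hℓ hc0 (fun x hx => hx.2) hN.ne'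
  rw [← Real.coe_toNNReal (c / Real.log ℓ) (by positivity)] at h1
  exact (le_dimH_of_hausdorffMeasure_ne_zero h1).trans (dimH_mono fun x hx => hx.1)

theorem HasEntropy.le_lowerDim [IsProbabilityMeasure m] (hm : HasEntropy ℓ m h)
    (hℓ : 1 < ℓ) (hsum : ∀ n, ∑ ε : Fin n → Fin ℓ, m (adicInterval ε) = 1) :
    ENNReal.ofReal (h / Real.log ℓ) ≤ lowerDim m := by
  have ht : Tendsto (fun c => ENNReal.ofReal (c / Real.log ℓ)) (𝓝[<] h)
      (𝓝 (ENNReal.ofReal (h / Real.log ℓ))) :=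
    ENNReal.tendsto_ofReal ((tendsto_id.div_const _).mono_left nhdsWithin_le_nhds)
  refine le_of_tendsto ht ?_
  filter_upwards [self_mem_nhdsWithin] with c hc
  exact hm.le_lowerDim_of_lt hℓ hsum hc

theorem lowerDim_le_upperDim [IsProbabilityMeasure m] : lowerDim m ≤ upperDim m :=
  le_iInf fun E => le_iInf fun hE => le_iInf fun h1 =>
    iInf₂_le_of_le E hE (iInf_le _ (by rw [h1]; exact one_pos))

end Dimension

/-! ### Conclusion. -/

theorem IsMarkovChain.one_lt {ℓ : ℕ} {Ω : Type*} [MeasurableSpace Ω] {Pr : Measure Ω}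
    {X : ℕ → Ω → Fin ℓ} {p : Fin ℓ → ℝ} {P : Matrix (Fin ℓ) (Fin ℓ) ℝ}
    (hX : IsMarkovChain Pr X p P) (hdeg : ∀ i j, P i j ≠ 1) : 1 < ℓ := by
  have hP := Matrix.mem_rowStochastic_iff_sum.1 hX.matrix_mem
  have h0 := hX.pos
  by_contra! hle
  obtain rfl : ℓ = 1 := by omega
  have := hP.2 0
  simp only [Finset.univ_unique, Finset.sum_singleton] at this
  exact hdeg _ _ this

end MarkovMeasure

theorem mainTheorem6 {ℓ : ℕ} {Ω : Type*} [MeasurableSpace Ω] (Pr : Measure Ω)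
    [IsProbabilityMeasure Pr] (X : ℕ → Ω → Fin ℓ) (p : Fin ℓ → ℝ)
    (P : Matrix (Fin ℓ) (Fin ℓ) ℝ) (hX : MarkovMeasure.IsMarkovChain Pr X p P)
    (hdeg : ∀ i j, P i j ≠ 1) (hirr : P.IsIrreducible) :
    ∃ d : ℝ≥0,
      HasDerivAt (MarkovMeasure.structureFunction ℓ (MarkovMeasure.drivenMeasure Pr X))
        (-(d : ℝ)) 1 ∧
      MarkovMeasure.lowerDim (MarkovMeasure.drivenMeasure Pr X) = d ∧
      MarkovMeasure.upperDim (MarkovMeasure.drivenMeasure Pr X) = d := by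
  obtain ⟨h, hh, hm⟩ := hX.exists_hasEntropy hdeg hirr
  have hℓ := hX.one_lt hdeg
  have hL : 0 < Real.log ℓ := Real.log_pos (by exact_mod_cast hℓ)
  have := MarkovMeasure.isProbabilityMeasure_drivenMeasure hX
  have hsum := hX.sum_real_adicInterval hdeg
  have hlow := hm.le_lowerDim hℓ hsum
  have hup := hm.upperDim_le hℓ hsum hh
  have hle := MarkovMeasure.lowerDim_le_upperDim (m := MarkovMeasure.drivenMeasure Pr X)
  refine ⟨(h / Real.log ℓ).toNNReal, ?_, le_antisymm (hle.trans hup) hlow,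
    le_antisymm hup (hlow.trans hle)⟩
  rw [Real.coe_toNNReal _ (by positivity)]
  exact hm.hasDerivAt_structureFunction hℓ
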